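/- Let $A$ be a complete regular local noetherian ring of dimension $n\geq 1$ with maximal ideal $\mathfrak m_A$, and let $k\subset A$ be a field of representatives, that is, a subfield such that the composition $k\to A\to A/\mathfrak m_A$ is an isomorphism. Let $G\subset \operatorname{Aut}(A)$ be a finite group of automorphisms of $A$ that fix every element of $k$. A family of $n$ elements of $A$ is called a system of parameters if it generates an $\mathfrak m_A$-primary ideal, and a regular system of parameters if it generates $\mathfrak m_A$. Let $u_1,\ldots,u_n$ be a regular system of parameters of $A$. It is called weakly admissible (resp. admissible) with respect to the action of $G$ if for every $(\sigma_1,\ldots,\sigma_n)\in G^n$ the elements $\sigma_1(u_1),\ldots,\sigma_n(u_n)$ form a system of parameters (resp. a regular system of parameters) of $A$. Let $x_i=\prod_{\sigma\in G}\sigma(u_i)$, $1\leq i\leq n$, be the associated norm elements. Then $x_1,\ldots,x_n$ form a system of parameters of $A$ if and only if $u_1,\ldots,u_n$ is weakly admissible with respect to the action of $G$. If these equivalent conditions hold, then the homomorphism of $k$-algebras $k[[x_1,\ldots,x_n]]\to A$ (the evaluation of formal power series in $n$ variables over $k$ at $x_1,\ldots,x_n$) is finite and flat, and its degree (the rank of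 $A$ as a free $k[[x_1,\ldots,x_n]]$-module) is at least $|G|^n$, with equality when $u_1,\ldots,u_n$ is admissible. -/

import Mathlib

namespace NormSubring

open IsLocalRing

section Parameters

/-- A system of parameters of a local ring `A`: a family of `n = dim A` elements that generates an
ideal primary to the maximal ideal. -/
def IsSystemOfParameters {A : Type*} [CommRing A] [IsLocalRing A] {n : ℕ} (x : Fin n → A) : Prop :=
  ringKrullDim A = n ∧
    (Ideal.span (Set.range x)).IsPrimary ∧
    (Ideal.span (Set.range x)).radical = maximalIdeal A

/-- A regular system of parameters of a local ring `A`: a family of `n = dim A` elements that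
generates the maximal ideal. -/
def IsRegularSystemOfParameters {A : Type*} [CommRing A] [IsLocalRing A] {n : ℕ}
    (u : Fin n → A) : Prop :=
  ringKrullDim A = n ∧ Ideal.span (Set.range u) = maximalIdeal A

theorem IsSystemOfParameters.mem {A : Type*} [CommRing A] [IsLocalRing A] {n : ℕ} {x : Fin n → A}
    (hx : IsSystemOfParameters x) (i : Fin n) : x i ∈ maximalIdeal A :=
  hx.2.2 ▸ Ideal.le_radical (Ideal.subset_span (Set.mem_range_self i))

end Parameters

/-- `k` is a field of representatives of the local `k`-algebra `A`: the composition
`k → A → A / 𝔪` is an isomorphism. -/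
def IsFieldOfRepresentatives (k A : Type*) [Field k] [CommRing A] [IsLocalRing A]
    [Algebra k A] : Prop :=
  Function.Bijective ((residue A).comp (algebraMap k A))

section Evaluation

open scoped MvPowerSeries.WithPiTopology

/-- The homomorphism of complete local `k`-algebras `k[[X₁, …, Xₙ]] → A` with `Xᵢ ↦ xᵢ`, for
elements `xᵢ` of the maximal ideal: evaluation of power series, where `k` is discrete and `A`
carries its `𝔪`-adic topology. -/
noncomputable def powerSeriesHom (k : Type*) {A : Type*} [Field k] [CommRing A] [IsLocalRing A]
    [Algebra k A] [IsAdicComplete (maximalIdeal A) A] {n : ℕ} (x : Fin n → A)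
    (hx : ∀ i, x i ∈ maximalIdeal A) : MvPowerSeries (Fin n) k →ₐ[k] A :=
  letI : UniformSpace k := ⊥
  haveI : DiscreteTopology k := ⟨rfl⟩
  haveI : IsUniformAddGroup k := inferInstance
  letI : WithIdeal A := ⟨maximalIdeal A⟩
  have hA : CompleteSpace A ∧ T2Space A :=
    (IsAdic.isAdicComplete_iff (I := maximalIdeal A) rfl).mp inferInstance
  haveI : CompleteSpace A := hA.1
  haveI : T2Space A := hA.2
  haveI : ContinuousSMul k A := DiscreteTopology.instContinuousSMul k A
  MvPowerSeries.aeval (R := k) (S := A) (a := x)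
    { hpow := fun i => WithIdeal.isTopologicallyNilpotent_of_mem (hx i)
      tendsto_zero := by simp [Filter.cofinite_eq_bot] }

theorem powerSeriesHom_X (k : Type*) {A : Type*} [Field k] [CommRing A] [IsLocalRing A]
    [Algebra k A] [IsAdicComplete (maximalIdeal A) A] {n : ℕ} (x : Fin n → A)
    (hx : ∀ i, x i ∈ maximalIdeal A) (i : Fin n) :
    powerSeriesHom k x hx (MvPowerSeries.X i) = x i := by
  let : UniformSpace k := ⊥
  have : DiscreteTopology k := ⟨rfl⟩
  let : WithIdeal A := ⟨maximalIdeal A⟩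
  have hA : CompleteSpace A ∧ T2Space A :=
    (IsAdic.isAdicComplete_iff (I := maximalIdeal A) rfl).mp inferInstance
  have : CompleteSpace A := hA.1
  have : T2Space A := hA.2
  have : ContinuousSMul k A := DiscreteTopology.instContinuousSMul k A
  have ha : MvPowerSeries.HasEval x :=
    { hpow := fun i => WithIdeal.isTopologicallyNilpotent_of_mem (hx i)
      tendsto_zero := by simp [Filter.cofinite_eq_bot] }
  have h := MvPowerSeries.aeval_coe (R := k) ha (MvPolynomial.X i)
  rw [MvPolynomial.coe_X, MvPolynomial.aeval_X] at h
  exact h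

end Evaluation

/-- The degree of a finite flat homomorphism `R → S` out of a local ring: the rank of the free
`R`-module `S`. -/
noncomputable def degree {R S : Type*} [CommRing R] [CommRing S] (f : R →+* S) : ℕ :=
  letI := f.toAlgebra
  Module.finrank R S

section Action

variable {k A : Type*} [Field k] [CommRing A] [Algebra k A] (G : Subgroup (A ≃ₐ[k] A))

/-- The norm element `∏_{σ ∈ G} σ(u)`. -/
def norm [Fintype G] (u : A) : A := ∏ σ : G, σ.1 u

/-- For all `(σ₁, …, σₙ) ∈ Gⁿ`, the elements `σ₁(u₁), …, σₙ(uₙ)` form a system of parameters. -/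
def IsWeaklyAdmissible [IsLocalRing A] {n : ℕ} (u : Fin n → A) : Prop :=
  ∀ σ : Fin n → G, IsSystemOfParameters fun i => (σ i).1 (u i)

/-- For all `(σ₁, …, σₙ) ∈ Gⁿ`, the elements `σ₁(u₁), …, σₙ(uₙ)` form a regular system of
parameters. -/
def IsAdmissible [IsLocalRing A] {n : ℕ} (u : Fin n → A) : Prop :=
  ∀ σ : Fin n → G, IsRegularSystemOfParameters fun i => (σ i).1 (u i)

end Action

end NormSubring

/-! A prime containing every norm `x i` contains a conjugate of each `u i`. Hence, if every choice
of conjugates is a system of parameters, so are the norms. Conversely, the ideal of the norms lies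
in the ideal of any choice of conjugates.

For the degree, `A` is regular, hence Cohen–Macaulay: any part of a system of parameters is a
regular sequence (`HasRegularSequence.sup_span_image`). It follows that `A` is free over `k[[x]]` of
rank `dim_k A ⧸ (x)` (`exists_linearEquiv_of_isRegularMod`). This length is computed by
multiplicativity: if `b` is regular modulo `I`, the length of `A ⧸ (I, ab)` is the sum of those of
`A ⧸ (I, a)` and `A ⧸ (I, b)` (`length_quotient_sup_mul`). Expanding the norms one at a time gives
the sum over `σ ∈ Gⁿ` of the lengths of `A ⧸ (σ₁u₁, …, σₙuₙ)`. Each of the `|G|ⁿ` terms is at least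
1, and equals 1 when the conjugates generate the maximal ideal. -/

namespace NormSubring

open IsLocalRing

/-! ### Regular sequences and depth of quotients `A ⧸ I`. -/

section Depth

variable {A : Type*} [CommRing A]

/-- The element `x` is a nonzerodivisor modulo the ideal `I`. -/
def IsRegularMod (I : Ideal A) (x : A) : Prop := ∀ a, x * a ∈ I → a ∈ I

theorem mem_sup_span_singleton {I : Ideal A} {x a : A} :
    a ∈ I ⊔ Ideal.span {x} ↔ ∃ b, a - x * b ∈ I := by
  rw [sup_comm, Ideal.mem_span_singleton_sup]
  constructor
  · rintro ⟨b, i, hi, rfl⟩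
    exact ⟨b, by convert hi using 1; ring⟩
  · rintro ⟨b, hb⟩
    exact ⟨b, _, hb, by ring⟩

theorem isRegularMod_iff [IsNoetherianRing A] {I : Ideal A} {x : A} :
    IsRegularMod I x ↔ ∀ P ∈ associatedPrimes A (A ⧸ I), x ∉ P := by
  have h := biUnion_associatedPrimes_eq_zero_divisors A (A ⧸ I)
  have hx : x ∈ ⋃ p ∈ associatedPrimes A (A ⧸ I), (p : Set A) ↔ ¬ IsRegularMod I x := by
    rw [h]
    simp only [Set.mem_ofPred_eq, IsRegularMod, not_forall]
    constructor
    · rintro ⟨y, hy, hxy⟩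
      obtain ⟨a, rfl⟩ := Ideal.Quotient.mk_surjective y
      refine ⟨a, ?_, fun ha => hy (Ideal.Quotient.eq_zero_iff_mem.2 ha)⟩
      rw [← Ideal.Quotient.eq_zero_iff_mem, map_mul]
      exact hxy
    · rintro ⟨a, ha, ha'⟩
      refine ⟨Ideal.Quotient.mk I a, fun h => ha' (Ideal.Quotient.eq_zero_iff_mem.1 h), ?_⟩
      rw [← Ideal.Quotient.eq_zero_iff_mem, map_mul] at ha
      exact ha
  rw [← not_iff_not, ← hx]
  simp

theorem exists_mem_iff_of_mem_associatedPrimes [IsNoetherianRing A] {I P : Ideal A}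
    (hP : P ∈ associatedPrimes A (A ⧸ I)) : ∃ a, a ∉ I ∧ ∀ t, t ∈ P ↔ t * a ∈ I := by
  obtain ⟨hP, y, rfl⟩ := isAssociatedPrime_iff.1 hP
  obtain ⟨a, rfl⟩ := Ideal.Quotient.mk_surjective y
  have key : ∀ t, t ∈ (⊥ : Submodule A (A ⧸ I)).colon {Ideal.Quotient.mk I a} ↔ t * a ∈ I := by
    intro t
    rw [Submodule.mem_colon_singleton, Submodule.mem_bot, ← Ideal.Quotient.eq_zero_iff_mem, map_mul]
    rfl
  refine ⟨a, fun ha => hP.ne_top ?_, key⟩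
  rw [Ideal.eq_top_iff_one, key, one_mul]
  exact ha

/-- If `x a ≡ z b` modulo `I`, then regularity of `z` gives `b ≡ x c`, and cancelling `x` gives `a ≡
z c`. -/
theorem IsRegularMod.sup_swap {I : Ideal A} {x z : A} (hx : IsRegularMod I x)
    (hz : IsRegularMod (I ⊔ Ideal.span {x}) z) : IsRegularMod (I ⊔ Ideal.span {z}) x := by
  intro a ha
  rw [mem_sup_span_singleton] at ha ⊢
  obtain ⟨b, hb⟩ := ha
  have hb' : b ∈ I ⊔ Ideal.span {x} := by
    refine hz b (mem_sup_span_singleton.2 ⟨a, ?_⟩)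
    convert I.neg_mem hb using 1; ring
  obtain ⟨c, hc⟩ := mem_sup_span_singleton.1 hb'
  refine ⟨c, hx _ ?_⟩
  convert I.add_mem hb (I.mul_mem_left z hc) using 1; ring

variable [IsLocalRing A]

theorem mem_of_forall_mul_mem_of_isRegularMod {I : Ideal A} {z : A} (hz : z ∈ maximalIdeal A)
    (h : IsRegularMod I z) (a : A) (ha : ∀ t ∈ maximalIdeal A, t * a ∈ I) : a ∈ I :=
  h a (ha z hz)

/-- The quotient `A ⧸ I` has a regular sequence of length `n` in the maximal ideal. -/
def HasRegularSequence : ℕ → Ideal A → Prop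
  | 0, _ => True
  | n + 1, I => ∃ x ∈ maximalIdeal A, IsRegularMod I x ∧ HasRegularSequence n (I ⊔ Ideal.span {x})

/-- Vanishing of the socle modulo a regular element does not depend on the element. Modulo `I`,
write `x a ≡ y v`; cancelling `y` shows that `v` is a socle element modulo `I + (x)`, where `z` is
regular. So `v ≡ x w`, and cancelling `x` gives `a ≡ y w`. -/
theorem mem_of_forall_mul_mem_exchange {I : Ideal A} {x y z : A} (hxm : x ∈ maximalIdeal A)
    (hx : IsRegularMod I x) (hzm : z ∈ maximalIdeal A)
    (hz : IsRegularMod (I ⊔ Ideal.span {x}) z) (hy : IsRegularMod I y) (a : A)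
    (ha : ∀ t ∈ maximalIdeal A, t * a ∈ I ⊔ Ideal.span {y}) : a ∈ I ⊔ Ideal.span {y} := by
  obtain ⟨v, hv⟩ := mem_sup_span_singleton.1 (ha x hxm)
  have hv' : v ∈ I ⊔ Ideal.span {x} := by
    refine mem_of_forall_mul_mem_of_isRegularMod hzm hz v fun t ht => ?_
    obtain ⟨s, hs⟩ := mem_sup_span_singleton.1 (ha t ht)
    refine mem_sup_span_singleton.2 ⟨s, hy _ ?_⟩
    convert I.sub_mem (I.mul_mem_left x hs) (I.mul_mem_left t hv) using 1; ring
  obtain ⟨w, hw⟩ := mem_sup_span_singleton.1 hv'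
  refine mem_sup_span_singleton.2 ⟨w, hx _ ?_⟩
  convert I.add_mem hv (I.mul_mem_left y hw) using 1; ring

variable [IsNoetherianRing A]

/-- Prime avoidance for nonzerodivisors modulo several ideals. -/
theorem exists_mem_maximalIdeal_isRegularMod (S : Set (Ideal A)) (hS : S.Finite)
    (h : ∀ I ∈ S, ∀ a, (∀ t ∈ maximalIdeal A, t * a ∈ I) → a ∈ I) :
    ∃ z ∈ maximalIdeal A, ∀ I ∈ S, IsRegularMod I z := by
  by_contra! hz
  have hfin : (⋃ I ∈ S, associatedPrimes A (A ⧸ I)).Finite :=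
    hS.biUnion fun I _ => associatedPrimes.finite A (A ⧸ I)
  have hsub : (maximalIdeal A : Set A) ⊆
      ⋃ P ∈ ⋃ I ∈ S, associatedPrimes A (A ⧸ I), (id P : Ideal A) := by
    intro z hzm
    obtain ⟨I, hI, hzI⟩ := hz z hzm
    rw [isRegularMod_iff] at hzI
    push Not at hzI
    obtain ⟨P, hP, hzP⟩ := hzI
    simp only [Set.mem_iUnion]
    exact ⟨P, ⟨I, hI, hP⟩, hzP⟩
  rw [Ideal.subset_union_prime_finite hfin ⊤ ⊤ (by
    intro P hP _ _
    simp only [Set.mem_iUnion] at hP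
    obtain ⟨I, -, hP⟩ := hP
    exact hP.isPrime)] at hsub
  obtain ⟨P, hP, hle⟩ := hsub
  simp only [Set.mem_iUnion] at hP
  obtain ⟨I, hI, hP⟩ := hP
  obtain ⟨a, ha, hPa⟩ := exists_mem_iff_of_mem_associatedPrimes hP
  exact ha (h I hI a fun t ht => (hPa t).1 (hle ht))

/-- Dividing out any nonzerodivisor of the maximal ideal lowers the depth by at most one. -/
theorem HasRegularSequence.sup_span_singleton {n : ℕ} {I : Ideal A}
    (h : HasRegularSequence (n + 1) I) {y : A} (hym : y ∈ maximalIdeal A)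
    (hy : IsRegularMod I y) : HasRegularSequence n (I ⊔ Ideal.span {y}) := by
  induction n generalizing I y with
  | zero => trivial
  | succ n ih =>
    obtain ⟨x, hxm, hx, h⟩ := h
    obtain ⟨w, hwm, hw, -⟩ := id h
    -- A `z` regular modulo both `I + (x)` and `I + (y)` links `x` to `y`: the induction hypothesis
    -- passes from `I + (x)` to `I + (x, z)`, hence to depth `n + 1` for `I + (z)`, and then to `I +
    -- (z, y)`.
    obtain ⟨z, hzm, hz⟩ := exists_mem_maximalIdeal_isRegularMod
      {I, I ⊔ Ideal.span {x}, I ⊔ Ideal.span {y}} (by simp) (by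
        simp only [Set.mem_insert_iff, Set.mem_singleton_iff, forall_eq_or_imp, forall_eq]
        exact ⟨mem_of_forall_mul_mem_of_isRegularMod hxm hx,
          mem_of_forall_mul_mem_of_isRegularMod hwm hw,
          mem_of_forall_mul_mem_exchange hxm hx hwm hw hy⟩)
    simp only [Set.mem_insert_iff, Set.mem_singleton_iff, forall_eq_or_imp, forall_eq] at hz
    obtain ⟨hzI, hzx, hzy⟩ := hz
    refine ⟨z, hzm, hzy, ?_⟩
    have h1 : HasRegularSequence (n + 1) (I ⊔ Ideal.span {z}) := by
      refine ⟨x, hxm, hx.sup_swap hzx, ?_⟩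
      have := ih h hzm hzx
      rwa [sup_right_comm] at this
    have := ih h1 hym (hy.sup_swap hzy)
    rwa [sup_right_comm] at this

end Depth

/-! ### Depth against dimension; regular local rings are Cohen–Macaulay domains. -/

section Dimension

variable {A : Type*} [CommRing A]

theorem ringKrullDim_quotient_sup_span_singleton (I : Ideal A) (x : A) :
    ringKrullDim ((A ⧸ I) ⧸ Ideal.span {Ideal.Quotient.mk I x}) =
      ringKrullDim (A ⧸ (I ⊔ Ideal.span {x})) := by
  have e := (DoubleQuot.quotQuotEquivQuotSup I (Ideal.span {x}))
  rw [Ideal.map_span, Set.image_singleton] at e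
  exact ringKrullDim_eq_of_ringEquiv e

theorem ringKrullDim_quotient_le_of_le {I J : Ideal A} (h : I ≤ J) :
    ringKrullDim (A ⧸ J) ≤ ringKrullDim (A ⧸ I) :=
  ringKrullDim_le_of_surjective (Ideal.Quotient.factor h) (Ideal.Quotient.factor_surjective h)

theorem ringKrullDim_quotient_sup_add_one_le (P : Ideal A) [P.IsPrime] {x : A} (hx : x ∉ P) :
    ringKrullDim (A ⧸ (P ⊔ Ideal.span {x})) + 1 ≤ ringKrullDim (A ⧸ P) := by
  rw [← ringKrullDim_quotient_sup_span_singleton]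
  apply ringKrullDim_quotient_succ_le_of_nonZeroDivisor
  rw [mem_nonZeroDivisors_iff_ne_zero]
  exact fun h => hx (Ideal.Quotient.eq_zero_iff_mem.1 h)

variable [IsLocalRing A]

theorem not_isUnit_quotient_mk {I : Ideal A} (hI : I ≤ maximalIdeal A) {x : A}
    (hx : x ∈ maximalIdeal A) : ¬ IsUnit (Ideal.Quotient.mk I x) := by
  intro hu
  obtain ⟨y, hy⟩ := hu.exists_right_inv
  obtain ⟨b, rfl⟩ := Ideal.Quotient.mk_surjective y
  rw [← map_mul, ← map_one (Ideal.Quotient.mk I), Ideal.Quotient.eq] at hy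
  refine (maximalIdeal.isMaximal A).ne_top ((Ideal.eq_top_iff_one _).2 ?_)
  have := (maximalIdeal A).sub_mem ((maximalIdeal A).mul_mem_right b hx) (hI hy)
  rwa [sub_sub_cancel] at this

variable [IsNoetherianRing A]

theorem ringKrullDim_quotient_le_add_one {I : Ideal A} (hI : I ≤ maximalIdeal A) {x : A}
    (hx : x ∈ maximalIdeal A) :
    ringKrullDim (A ⧸ I) ≤ ringKrullDim (A ⧸ (I ⊔ Ideal.span {x})) + 1 := by
  have hI' : I ≠ ⊤ := fun h => (maximalIdeal.isMaximal A).ne_top (top_le_iff.1 (h ▸ hI))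
  have : Nontrivial (A ⧸ I) := Ideal.Quotient.nontrivial_iff.2 hI'
  have : IsLocalRing (A ⧸ I) := IsLocalRing.of_surjective' _ Ideal.Quotient.mk_surjective
  have h := ringKrullDim_le_ringKrullDim_quotient_add_encard {Ideal.Quotient.mk I x} (by
    rw [Set.singleton_subset_iff, SetLike.mem_coe, IsLocalRing.ringJacobson_eq_maximalIdeal,
      IsLocalRing.mem_maximalIdeal, mem_nonunits_iff]
    exact not_isUnit_quotient_mk hI hx)
  rw [ringKrullDim_quotient_sup_span_singleton] at h
  simpa using h

/-- Krull's height theorem in `A ⧸ I`, whose maximal ideal is minimal over the images of the `v i`.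
With `T` empty it detects dimension zero. -/
theorem ringKrullDim_quotient_le_card {ι : Type*} {I : Ideal A} (hI : I ≤ maximalIdeal A)
    (T : Finset ι) (v : ι → A) (hvm : ∀ i ∈ T, v i ∈ maximalIdeal A)
    (hv : maximalIdeal A ≤ (I ⊔ Ideal.span (v '' T)).radical) :
    ringKrullDim (A ⧸ I) ≤ T.card := by
  classical
  have hI' : I ≠ ⊤ := fun h => (maximalIdeal.isMaximal A).ne_top (top_le_iff.1 (h ▸ hI))
  have : Nontrivial (A ⧸ I) := Ideal.Quotient.nontrivial_iff.2 hI'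
  have : IsLocalRing (A ⧸ I) := IsLocalRing.of_surjective' _ Ideal.Quotient.mk_surjective
  have hm : Ideal.span (((T.image fun i => Ideal.Quotient.mk I (v i)) : Finset (A ⧸ I)) :
      Set (A ⧸ I)) ≤ maximalIdeal (A ⧸ I) := by
    rw [Ideal.span_le, Finset.coe_image]
    rintro _ ⟨i, hi, rfl⟩
    exact not_isUnit_quotient_mk hI (hvm i hi)
  have hmin : maximalIdeal (A ⧸ I) ∈ (Ideal.span
      (((T.image fun i => Ideal.Quotient.mk I (v i)) : Finset (A ⧸ I)) : Set _)).minimalPrimes := by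
    refine ⟨⟨inferInstance, hm⟩, fun q hq _ => ?_⟩
    have := hq.1
    have h1 : (I ⊔ Ideal.span (v '' T)) ≤ q.comap (Ideal.Quotient.mk I) := by
      refine sup_le ?_ (Ideal.span_le.2 ?_)
      · intro a ha
        rw [Ideal.mem_comap, Ideal.Quotient.eq_zero_iff_mem.2 ha]
        exact q.zero_mem
      · rintro _ ⟨i, hi, rfl⟩
        refine hq.2 (Ideal.subset_span ?_)
        rw [Finset.coe_image]
        exact ⟨i, hi, rfl⟩
    have h2 := hv.trans ((Ideal.IsPrime.radical_le_iff inferInstance).2 h1)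
    intro y hy
    obtain ⟨a, rfl⟩ := Ideal.Quotient.mk_surjective y
    refine h2 ((IsLocalRing.mem_maximalIdeal a).2 fun hu => ?_)
    exact (IsLocalRing.mem_maximalIdeal _).1 hy (hu.map _)
  have := Ideal.height_le_card_of_mem_minimalPrimes_span_finset hmin
  rw [← IsLocalRing.maximalIdeal_height_eq_ringKrullDim]
  exact_mod_cast this.trans (by exact_mod_cast Finset.card_image_le)

/-- Depth is at most the dimension at every associated prime. Some associated prime `Q` of `A ⧸ (I +
(x))` contains `P + (x)`, and passing from `P` to `P + (x)` lowers the dimension by at least one. -/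
theorem HasRegularSequence.le_ringKrullDim {n : ℕ} {I P : Ideal A} (h : HasRegularSequence n I)
    (hP : P ∈ associatedPrimes A (A ⧸ I)) : n ≤ ringKrullDim (A ⧸ P) := by
  induction n generalizing I P with
  | zero =>
    have := hP.isPrime
    simpa using ringKrullDim_nonneg_of_nontrivial
  | succ n ih =>
    obtain ⟨x, hxm, hx, h⟩ := h
    have hPp := hP.isPrime
    have hxP : x ∉ P := isRegularMod_iff.1 hx P hP
    obtain ⟨a, haI, ha⟩ := exists_mem_iff_of_mem_associatedPrimes hP
    have hIP : I ≤ P := fun t ht => (ha t).2 (I.mul_mem_right a ht)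
    -- an element killed by `P` modulo `I` that is nonzero modulo `I + (x)`
    obtain ⟨b, hbP, hb⟩ : ∃ b, (∀ t ∈ P, t * b ∈ I) ∧ b ∉ I ⊔ Ideal.span {x} := by
      by_contra! hcon
      let N : Ideal A :=
        { carrier := {b | ∀ t ∈ P, t * b ∈ I}
          add_mem' := fun {b c} hb hc t ht => by rw [mul_add]; exact I.add_mem (hb t ht) (hc t ht)
          zero_mem' := fun t _ => by simp
          smul_mem' := fun c b hb t ht => by
            rw [smul_eq_mul, mul_left_comm]; exact I.mul_mem_left c (hb t ht) }
      -- `N` is the colon ideal `(I : P)`. Were it inside `I + (x)`, regularity of `x` would give `N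
      -- ≤ I + 𝔪 N`, so `N ≤ I` by Nakayama, contradicting the choice of `a`.
      have hN : N ≤ I := by
        refine Submodule.le_of_le_smul_of_le_jacobson_bot (IsNoetherian.noetherian N)
          (IsLocalRing.maximalIdeal_le_jacobson ⊥) fun b hb => ?_
        obtain ⟨c, hc⟩ := mem_sup_span_singleton.1 (hcon b hb)
        have hcN : c ∈ N := by
          intro t ht
          refine hx _ ?_
          convert I.sub_mem (hb t ht) (I.mul_mem_left t hc) using 1; ring
        rw [← sub_add_cancel b (x * c)]
        exact Submodule.add_mem_sup hc (Submodule.smul_mem_smul hxm hcN)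
      exact haI (hN fun t ht => (ha t).1 ht)
    have hb0 : (Submodule.Quotient.mk b : A ⧸ (I ⊔ Ideal.span {x})) ≠ 0 := by
      rwa [Ne, Submodule.Quotient.mk_eq_zero]
    obtain ⟨Q, hQ, hle⟩ := exists_le_isAssociatedPrime_of_isNoetherianRing A _ hb0
    have hPQ : P ⊔ Ideal.span {x} ≤ Q := by
      refine le_trans (fun t ht => ?_) hle
      rw [Submodule.mem_colon_singleton, Submodule.mem_bot, ← Submodule.Quotient.mk_smul,
        Submodule.Quotient.mk_eq_zero, smul_eq_mul]
      obtain ⟨c, hc⟩ := mem_sup_span_singleton.1 ht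
      refine mem_sup_span_singleton.2 ⟨c * b, ?_⟩
      convert hbP _ hc using 1; ring
    refine le_trans ?_ (ringKrullDim_quotient_sup_add_one_le P hxP)
    push_cast
    exact add_le_add_left ((ih h hQ).trans (ringKrullDim_quotient_le_of_le hPQ)) 1

/-- If `x` lay in an associated prime `P`, the elements `v i` for `i ∈ T` would bound `dim A ⧸ P` by
`T.card`, while the depth forces it to be at least `T.card + 1`. -/
theorem HasRegularSequence.isRegularMod {ι : Type*} {I : Ideal A}
    (T : Finset ι) (v : ι → A) (hvm : ∀ i ∈ T, v i ∈ maximalIdeal A)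
    (h : HasRegularSequence (T.card + 1) I) {x : A}
    (hv : maximalIdeal A ≤ (I ⊔ Ideal.span {x} ⊔ Ideal.span (v '' T)).radical) :
    IsRegularMod I x := by
  rw [isRegularMod_iff]
  intro P hP hxP
  have hPp := hP.isPrime
  have h1 := h.le_ringKrullDim hP
  obtain ⟨a, -, ha⟩ := exists_mem_iff_of_mem_associatedPrimes hP
  have hIP : I ≤ P := fun t ht => (ha t).2 (I.mul_mem_right a ht)
  have h2 := ringKrullDim_quotient_le_card (IsLocalRing.le_maximalIdeal hPp.ne_top) T v hvm
    (hv.trans (Ideal.radical_mono (sup_le_sup_right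
      (sup_le hIP ((Ideal.span_singleton_le_iff_mem P).2 hxP)) _)))
  have h3 := h1.trans h2
  norm_cast at h3
  omega

/-- In a local ring of maximal depth, any part of a system of parameters is a regular sequence. -/
theorem HasRegularSequence.sup_span_image {n : ℕ} {v : Fin n → A}
    (hvm : ∀ i, v i ∈ maximalIdeal A) (h : HasRegularSequence n (⊥ : Ideal A))
    (hv : maximalIdeal A ≤ (Ideal.span (Set.range v)).radical) (S : Finset (Fin n)) :
    HasRegularSequence Sᶜ.card (Ideal.span (v '' S)) ∧
      ∀ j ∉ S, IsRegularMod (Ideal.span (v '' S)) (v j) := by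
  have hle (S : Finset (Fin n)) : Ideal.span (v '' S) ≤ maximalIdeal A :=
    Ideal.span_le.2 (by rintro _ ⟨i, -, rfl⟩; exact hvm i)
  have hreg (S : Finset (Fin n)) (hS : HasRegularSequence Sᶜ.card (Ideal.span (v '' S))) (j)
      (hj : j ∉ S) : IsRegularMod (Ideal.span (v '' S)) (v j) := by
    refine HasRegularSequence.isRegularMod (Sᶜ.erase j) v (fun i _ => hvm i) ?_ ?_
    · rwa [Finset.card_erase_add_one (by simpa using hj)]
    · refine hv.trans (Ideal.radical_mono (Ideal.span_le.2 ?_))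
      rintro _ ⟨i, rfl⟩
      by_cases hi : i ∈ S
      · exact Ideal.mem_sup_left (Ideal.mem_sup_left (Ideal.subset_span ⟨i, hi, rfl⟩))
      · by_cases hij : i = j
        · subst hij
          exact Ideal.mem_sup_left (Ideal.mem_sup_right (Ideal.mem_span_singleton_self _))
        · exact Ideal.mem_sup_right (Ideal.subset_span ⟨i, by simp [hi, hij], rfl⟩)
  have key : HasRegularSequence Sᶜ.card (Ideal.span (v '' S)) := by
    induction S using Finset.induction_on with
    | empty => simpa using h
    | insert j S hj ih =>
      have hc : (insert j S)ᶜ.card + 1 = Sᶜ.card := by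
        rw [Finset.compl_insert, Finset.card_erase_add_one (by simpa using hj)]
      rw [Finset.coe_insert, Set.image_insert_eq, Ideal.span_insert, sup_comm]
      exact HasRegularSequence.sup_span_singleton (by rwa [hc]) (hvm j) (hreg S ih j hj)
  exact ⟨key, hreg S key⟩

/-- The hypotheses say that `A ⧸ I` is regular local of dimension `n`. Cutting by an `x` outside `I
+ 𝔪²` and outside the minimal primes of `I` leaves a regular ring of dimension one less, so `I +
(x)` is prime by induction. A minimal prime `P ≤ I + (x)` of `I` then satisfies `P ≤ I + 𝔪 P`, and
Nakayama gives `P = I`. -/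
theorem isPrime_and_hasRegularSequence {n : ℕ} {I : Ideal A} {v : Fin n → A}
    (hv : maximalIdeal A = I ⊔ Ideal.span (Set.range v)) (hd : ringKrullDim (A ⧸ I) = n) :
    I.IsPrime ∧ HasRegularSequence n I := by
  induction n generalizing I with
  | zero =>
    refine ⟨?_, trivial⟩
    rw [Set.range_eq_empty, Ideal.span_empty, sup_bot_eq] at hv
    rw [← hv]
    infer_instance
  | succ n ih =>
    have hI : I ≤ maximalIdeal A := hv ▸ le_sup_left
    have hne : I ≠ maximalIdeal A := by
      intro h
      have h0 : ringKrullDim (A ⧸ I) ≤ (0 : ℕ) := by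
        refine ringKrullDim_quotient_le_card hI (∅ : Finset (Fin 0)) Fin.elim0 (by simp) ?_
        rw [h]
        exact le_sup_left.trans Ideal.le_radical
      rw [hd] at h0
      norm_cast at h0
    obtain ⟨x, hxm, hx2, hxI⟩ : ∃ x ∈ maximalIdeal A, x ∉ I ⊔ maximalIdeal A ^ 2 ∧
        ∀ P ∈ I.minimalPrimes, x ∉ P := by
      by_contra! hcon
      have hfin : (insert (I ⊔ maximalIdeal A ^ 2) I.minimalPrimes).Finite :=
        (I.finite_minimalPrimes_of_isNoetherianRing A).insert _
      have hsub : (maximalIdeal A : Set A) ⊆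
          ⋃ P ∈ insert (I ⊔ maximalIdeal A ^ 2) I.minimalPrimes, (id P : Ideal A) := by
        intro x hx
        simp only [Set.mem_iUnion]
        by_cases h2 : x ∈ I ⊔ maximalIdeal A ^ 2
        · exact ⟨_, Set.mem_insert _ _, h2⟩
        · obtain ⟨P, hP, hxP⟩ := hcon x hx h2
          exact ⟨P, Set.mem_insert_of_mem _ hP, hxP⟩
      -- Prime avoidance tolerates two exceptional ideals; only `I + 𝔪²` may fail to be prime, so it
      -- fills both places.
      rw [Ideal.subset_union_prime_finite hfin (I ⊔ maximalIdeal A ^ 2) (I ⊔ maximalIdeal A ^ 2) (by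
        intro P hP h1 _
        exact (hP.resolve_left h1).1.1)] at hsub
      obtain ⟨P, rfl | hP, hle⟩ := hsub
      · refine hne (le_antisymm hI ?_)
        refine Submodule.le_of_le_smul_of_le_jacobson_bot (IsNoetherian.noetherian _)
          (IsLocalRing.maximalIdeal_le_jacobson ⊥) (hle.trans ?_)
        rw [id, pow_two]
        rfl
      · have hPp := hP.1.1
        have hPm : P = maximalIdeal A := le_antisymm (IsLocalRing.le_maximalIdeal hPp.ne_top) hle
        have h0 := ringKrullDim_quotient_le_card hI (∅ : Finset (Fin 0)) Fin.elim0 (by simp) (by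
          rw [← Ideal.sInf_minimalPrimes, Finset.coe_empty, Set.image_empty, Ideal.span_empty,
            sup_bot_eq]
          refine le_sInf fun Q hQ => ?_
          have hQp := hQ.1.1
          exact (hP.2 hQ.1 (hPm ▸ IsLocalRing.le_maximalIdeal hQp.ne_top)).trans' hle)
        rw [hd] at h0
        norm_cast at h0
    obtain ⟨w, hw⟩ : ∃ w : Fin n → A,
        maximalIdeal A = I ⊔ Ideal.span {x} ⊔ Ideal.span (Set.range w) := by
      have hvm : ∀ j, v j ∈ maximalIdeal A := fun j => by
        rw [hv]; exact Ideal.mem_sup_right (Ideal.subset_span ⟨j, rfl⟩)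
      obtain ⟨i, hi, y, hy, hxy⟩ := Submodule.mem_sup.1 (hv ▸ hxm)
      obtain ⟨c, hc⟩ := Ideal.mem_span_range_iff_exists_fun.1 hy
      -- Since `x ∉ I + 𝔪²`, some coefficient is a unit, so `x` can replace `v j` among the
      -- generators.
      obtain ⟨j, hj⟩ : ∃ j, IsUnit (c j) := by
        by_contra! hcon
        refine hx2 (hxy ▸ Submodule.add_mem_sup hi (hc ▸ Ideal.sum_mem _ fun j _ => ?_))
        rw [pow_two]
        exact Ideal.mul_mem_mul ((IsLocalRing.mem_maximalIdeal _).2 (hcon j)) (hvm j)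
      refine ⟨v ∘ j.succAbove, le_antisymm ?_ ?_⟩
      · have hw (k) : v (j.succAbove k) ∈
            I ⊔ Ideal.span {x} ⊔ Ideal.span (Set.range (v ∘ j.succAbove)) :=
          Ideal.mem_sup_right (Ideal.subset_span ⟨k, rfl⟩)
        nth_rw 1 [hv]
        refine sup_le (le_sup_left.trans le_sup_left) (Ideal.span_le.2 ?_)
        rintro _ ⟨k, rfl⟩
        rcases Fin.eq_self_or_eq_succAbove j k with rfl | ⟨k, rfl⟩
        · rw [SetLike.mem_coe, ← Ideal.unit_mul_mem_iff_mem _ hj]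
          rw [Fin.sum_univ_succAbove _ k] at hc
          have : c k * v k = x - i - ∑ l, c (k.succAbove l) * v (k.succAbove l) := by
            rw [← hxy, ← hc]; ring
          rw [this]
          refine Ideal.sub_mem _ (Ideal.sub_mem _ ?_ ?_)
            (Ideal.sum_mem _ fun l _ => Ideal.mul_mem_left _ _ (hw l))
          · exact Ideal.mem_sup_left (Ideal.mem_sup_right (Ideal.mem_span_singleton_self x))
          · exact Ideal.mem_sup_left (Ideal.mem_sup_left hi)
        · exact hw k
      · refine sup_le (sup_le hI ((Ideal.span_singleton_le_iff_mem _).2 hxm)) (Ideal.span_le.2 ?_)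
        rintro _ ⟨k, rfl⟩
        exact hvm _
    have hJ : I ⊔ Ideal.span {x} ≤ maximalIdeal A :=
      sup_le hI ((Ideal.span_singleton_le_iff_mem _).2 hxm)
    have hdJ : ringKrullDim (A ⧸ (I ⊔ Ideal.span {x})) = n := by
      apply le_antisymm
      · have := ringKrullDim_quotient_le_card hJ Finset.univ w (fun i _ => by
          rw [hw]; exact Ideal.mem_sup_right (Ideal.subset_span ⟨i, rfl⟩)) (by
          rw [Finset.coe_univ, Set.image_univ, ← hw]; exact Ideal.le_radical)
        simpa using this
      · have := ringKrullDim_quotient_le_add_one hI hxm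
        rw [hd] at this
        push_cast at this
        exact (WithBot.add_le_add_iff_right' WithBot.one_ne_bot (fun h =>
          ENat.one_ne_top (WithBot.coe_injective h))).1 this
    obtain ⟨hp, hr⟩ := ih hw hdJ
    have hIp : I.IsPrime := by
      obtain ⟨P, hP, hPJ⟩ := Ideal.exists_minimalPrimes_le (show I ≤ I ⊔ Ideal.span {x} from le_sup_left)
      have hPp := hP.1.1
      have hPI : P ≤ I := by
        refine Submodule.le_of_le_smul_of_le_jacobson_bot (IsNoetherian.noetherian P)
          (IsLocalRing.maximalIdeal_le_jacobson ⊥) fun b hb => ?_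
        obtain ⟨c, hc⟩ := mem_sup_span_singleton.1 (hPJ hb)
        have hcP : c ∈ P := by
          have : x * c ∈ P := by
            have := P.sub_mem hb (hP.1.2 hc)
            rwa [sub_sub_cancel] at this
          exact (hPp.mem_or_mem this).resolve_left (hxI P hP)
        rw [← sub_add_cancel b (x * c)]
        exact Submodule.add_mem_sup hc (Submodule.smul_mem_smul hxm hcP)
      rwa [le_antisymm hP.1.2 hPI]
    refine ⟨hIp, x, hxm, fun a ha => (hIp.mem_or_mem ha).resolve_left ?_, hr⟩
    exact hxI I (by rw [Ideal.minimalPrimes_eq_subsingleton_self]; rfl)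

end Dimension

/-! ### Additivity of length along products. -/

section Length

variable (k : Type*) {A : Type*} [CommRing k] [CommRing A] [Algebra k A]

/-- Multiplication by `b` gives the exact sequence `0 → A ⧸ (I, a) → A ⧸ (I, ab) → A ⧸ (I, b) → 0`;
regularity of `b` is its injectivity on the left. -/
theorem length_quotient_sup_mul {I : Ideal A} {a b : A} (hb : IsRegularMod I b) :
    Module.length k (A ⧸ (I ⊔ Ideal.span {a * b})) =
      Module.length k (A ⧸ (I ⊔ Ideal.span {a})) +
        Module.length k (A ⧸ (I ⊔ Ideal.span {b})) := by
  have hf : I ⊔ Ideal.span {a} ≤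
      Submodule.comap (LinearMap.mulLeft A b) (I ⊔ Ideal.span {a * b}) := by
    intro t ht
    obtain ⟨c, hc⟩ := mem_sup_span_singleton.1 ht
    refine mem_sup_span_singleton.2 ⟨c, ?_⟩
    rw [LinearMap.mulLeft_apply]
    convert I.mul_mem_left b hc using 1; ring
  have hg : I ⊔ Ideal.span {a * b} ≤ I ⊔ Ideal.span {b} := by
    refine sup_le_sup_left (Ideal.span_singleton_le_span_singleton.2 (Dvd.intro_left a rfl)) I
  let f : (A ⧸ (I ⊔ Ideal.span {a})) →ₗ[A] (A ⧸ (I ⊔ Ideal.span {a * b})) :=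
    Submodule.mapQ _ _ (LinearMap.mulLeft A b) hf
  let g : (A ⧸ (I ⊔ Ideal.span {a * b})) →ₗ[A] (A ⧸ (I ⊔ Ideal.span {b})) :=
    Submodule.factor hg
  refine Module.length_eq_add_of_exact (f.restrictScalars k) (g.restrictScalars k) ?_ ?_ ?_
  · rw [LinearMap.coe_restrictScalars, ← LinearMap.ker_eq_bot, LinearMap.ker_eq_bot']
    intro y hy
    obtain ⟨z, rfl⟩ := Submodule.Quotient.mk_surjective _ y
    change Submodule.Quotient.mk (b * z) = 0 at hy
    rw [Submodule.Quotient.mk_eq_zero] at hy ⊢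
    obtain ⟨c, hc⟩ := mem_sup_span_singleton.1 hy
    refine mem_sup_span_singleton.2 ⟨c, hb _ ?_⟩
    convert hc using 1; ring
  · exact Submodule.factor_surjective hg
  · intro y
    obtain ⟨z, rfl⟩ := Submodule.Quotient.mk_surjective _ y
    change Submodule.Quotient.mk z = 0 ↔ _
    rw [Submodule.Quotient.mk_eq_zero, mem_sup_span_singleton]
    constructor
    · rintro ⟨c, hc⟩
      refine ⟨Submodule.Quotient.mk c, ?_⟩
      change Submodule.Quotient.mk (b * c) = Submodule.Quotient.mk z
      rw [eq_comm, Submodule.Quotient.eq]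
      exact Ideal.mem_sup_left hc
    · rintro ⟨y, hy⟩
      obtain ⟨c, rfl⟩ := Submodule.Quotient.mk_surjective _ y
      change Submodule.Quotient.mk (b * c) = Submodule.Quotient.mk z at hy
      rw [eq_comm, Submodule.Quotient.eq] at hy
      exact mem_sup_span_singleton.1 (hg hy) |>.imp' (· + c) fun d hd => by
        convert hd using 1; ring

theorem length_quotient_sup_prod {I : Ideal A} {τ : Type*} (s : Finset τ) (f : τ → A)
    (hf : ∀ t ∈ s, IsRegularMod I (f t)) :
    Module.length k (A ⧸ (I ⊔ Ideal.span {∏ t ∈ s, f t})) =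
      ∑ t ∈ s, Module.length k (A ⧸ (I ⊔ Ideal.span {f t})) := by
  classical
  induction s using Finset.induction_on with
  | empty =>
    rw [Finset.prod_empty, Finset.sum_empty, Module.length_eq_zero_iff,
      Ideal.Quotient.subsingleton_iff, Ideal.span_singleton_one, sup_top_eq]
  | insert t s ht ih =>
    rw [Finset.prod_insert ht, Finset.sum_insert ht, mul_comm,
      length_quotient_sup_mul k (hf t (Finset.mem_insert_self t s)),
      ih fun r hr => hf r (Finset.mem_insert_of_mem hr), add_comm]

end Length

theorem span_range_update {A : Type*} [CommRing A] {n : ℕ} (v : Fin n → A) (i : Fin n) (a : A) :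
    Ideal.span (Set.range (Function.update v i a)) =
      Ideal.span (v '' (({i}ᶜ : Finset (Fin n)) : Set (Fin n))) ⊔ Ideal.span {a} := by
  apply le_antisymm
  · refine Ideal.span_le.2 ?_
    rintro _ ⟨j, rfl⟩
    by_cases hj : j = i
    · subst hj
      rw [Function.update_self]
      exact Ideal.mem_sup_right (Ideal.mem_span_singleton_self a)
    · rw [Function.update_of_ne hj]
      exact Ideal.mem_sup_left (Ideal.subset_span ⟨j, by simpa using hj, rfl⟩)
  · refine sup_le (Ideal.span_le.2 ?_) (Ideal.span_le.2 ?_)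
    · rintro _ ⟨j, hj, rfl⟩
      have hj : j ≠ i := by simpa using hj
      exact Ideal.subset_span ⟨j, Function.update_of_ne hj _ _⟩
    · rintro _ rfl
      exact Ideal.subset_span ⟨i, Function.update_self _ _ _⟩

/-! ### Systems of parameters and fields of representatives. -/

section LocalRing

variable {A : Type*} [CommRing A] [IsLocalRing A]

theorem isSystemOfParameters_iff {n : ℕ} (hdim : ringKrullDim A = n) {x : Fin n → A} :
    IsSystemOfParameters x ↔
      (∀ i, x i ∈ maximalIdeal A) ∧ maximalIdeal A ≤ (Ideal.span (Set.range x)).radical := by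
  refine ⟨fun h => ⟨h.mem, h.2.2.ge⟩, fun ⟨h1, h2⟩ => ?_⟩
  have h3 : (Ideal.span (Set.range x)).radical = maximalIdeal A := by
    refine le_antisymm ((Ideal.IsPrime.radical_le_iff inferInstance).2 (Ideal.span_le.2 ?_)) h2
    rintro _ ⟨i, rfl⟩
    exact h1 i
  exact ⟨hdim, Ideal.isPrimary_of_isMaximal_radical (h3 ▸ maximalIdeal.isMaximal A), h3⟩

theorem IsFieldOfRepresentatives.length_quotient_maximalIdeal {k : Type*} [Field k] [Algebra k A]
    (hk : IsFieldOfRepresentatives k A) : Module.length k (A ⧸ maximalIdeal A) = 1 := by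
  have e : k ≃ₗ[k] (A ⧸ maximalIdeal A) :=
    LinearEquiv.ofBijective (Algebra.linearMap k (A ⧸ maximalIdeal A)) hk
  rw [← e.length_eq]
  exact Module.length_eq_one k k

variable [IsNoetherianRing A]

theorem IsRegularSystemOfParameters.hasRegularSequence {n : ℕ} {u : Fin n → A}
    (hu : IsRegularSystemOfParameters u) : HasRegularSequence n (⊥ : Ideal A) := by
  refine (isPrime_and_hasRegularSequence (I := ⊥) (v := u) ?_ ?_).2
  · rw [bot_sup_eq, hu.2]
  · rw [← hu.1]
    exact ringKrullDim_eq_of_ringEquiv (RingEquiv.quotientBot A)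

theorem isRegularMod_of_isSystemOfParameters_update {n : ℕ}
    (h : HasRegularSequence n (⊥ : Ideal A)) {v : Fin n → A} {i : Fin n} {b : A}
    (hv : IsSystemOfParameters (Function.update v i b)) :
    IsRegularMod (Ideal.span (v '' (({i}ᶜ : Finset (Fin n)) : Set (Fin n)))) b := by
  have := (HasRegularSequence.sup_span_image hv.mem h hv.2.2.ge {i}ᶜ).2 i (by simp)
  rw [Function.update_self] at this
  convert this using 2
  refine Set.image_congr fun j hj => ?_
  have hj : j ≠ i := by simpa using hj
  rw [Function.update_of_ne hj]

/-- A quotient by an ideal primary to the maximal ideal is finite over a field of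
representatives. -/
theorem IsFieldOfRepresentatives.finite_quotient {k : Type*} [Field k] [Algebra k A]
    (hk : IsFieldOfRepresentatives k A) {I : Ideal A} (hI : maximalIdeal A ≤ I.radical) :
    Module.Finite k (A ⧸ I) := by
  have hres (a : A) : ∃ c : k, a - algebraMap k A c ∈ maximalIdeal A := by
    obtain ⟨c, hc⟩ := hk.2 (residue A a)
    refine ⟨c, ?_⟩
    rw [← residue_eq_zero_iff, map_sub, ← hc]
    exact sub_self _
  -- `A` is spanned over `k` modulo `𝔪 ^ N` by finitely many elements: at each stage, add generators
  -- of `𝔪 ^ N`, whose coefficients matter only modulo `𝔪` and so can be taken in `k`.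
  have key (N : ℕ) : ∃ V : Submodule k A, V.FG ∧ ∀ a, ∃ v ∈ V, a - v ∈ maximalIdeal A ^ N := by
    induction N with
    | zero => exact ⟨⊥, Submodule.fg_bot, fun a => ⟨0, zero_mem _, by simp⟩⟩
    | succ N ih =>
      obtain ⟨V, hV, h⟩ := ih
      obtain ⟨S, hS⟩ := IsNoetherian.noetherian (maximalIdeal A ^ N)
      refine ⟨V ⊔ Submodule.span k S, hV.sup (Submodule.fg_span S.finite_toSet), fun a => ?_⟩
      obtain ⟨v, hv, hav⟩ := h a
      rw [← hS] at hav
      obtain ⟨c, -, hc⟩ := Submodule.mem_span_finset.1 hav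
      choose d hd using fun s => hres (c s)
      refine ⟨v + ∑ s ∈ S, d s • s, Submodule.add_mem_sup hv (Submodule.sum_mem _ fun s hs =>
        Submodule.smul_mem _ _ (Submodule.subset_span hs)), ?_⟩
      rw [← sub_sub, ← hc, ← Finset.sum_sub_distrib]
      refine Ideal.sum_mem _ fun s hs => ?_
      rw [smul_eq_mul, Algebra.smul_def, ← sub_mul, pow_succ']
      exact Ideal.mul_mem_mul (hd s) (hS ▸ Submodule.subset_span hs)
  obtain ⟨N, hN⟩ := Ideal.exists_radical_pow_le_of_fg I (IsNoetherian.noetherian _)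
  obtain ⟨V, hV, h⟩ := key N
  have htop : V.map (Ideal.Quotient.mkₐ k I).toLinearMap = ⊤ := by
    rw [eq_top_iff]
    intro y _
    obtain ⟨a, rfl⟩ := Ideal.Quotient.mk_surjective y
    obtain ⟨v, hv, hav⟩ := h a
    refine ⟨v, hv, ?_⟩
    change Ideal.Quotient.mk I v = Ideal.Quotient.mk I a
    rw [eq_comm, Ideal.Quotient.eq]
    exact hN (Ideal.pow_right_mono hI N hav)
  exact ⟨htop ▸ hV.map _⟩

end LocalRing

/-! ### Norms, conjugates and the count of `|G|ⁿ` terms. -/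

section Action

variable {k A : Type*} [Field k] [CommRing A] [Algebra k A]
  (G : Subgroup (A ≃ₐ[k] A)) [Fintype G] {n : ℕ}

theorem norm_mem {I : Ideal A} {a : A} (σ : G) (h : σ.1 a ∈ I) : norm G a ∈ I :=
  I.mem_of_dvd (Finset.dvd_prod_of_mem (fun τ : G => τ.1 a) (Finset.mem_univ σ)) h

/-- The family of the norms of `u i` for `i ∈ T` and of the conjugates `σ i (u i)` for `i ∉ T`. -/
def mixedNorm (u : Fin n → A) (T : Finset (Fin n)) (σ : Fin n → G) (i : Fin n) : A :=
  if i ∈ T then norm G (u i) else (σ i).1 (u i)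

theorem mixedNorm_insert (u : Fin n → A) (T : Finset (Fin n)) (σ : Fin n → G) (i : Fin n) :
    mixedNorm G u (insert i T) σ =
      Function.update (mixedNorm G u T σ) i (∏ τ : G, τ.1 (u i)) := by
  funext j
  by_cases hj : j = i
  · subst hj; simp [mixedNorm, norm]
  · simp [mixedNorm, hj]

theorem mixedNorm_update (u : Fin n → A) {T : Finset (Fin n)} (σ : Fin n → G) {i : Fin n}
    (hi : i ∉ T) (τ : G) :
    mixedNorm G u T (Function.update σ i τ) =
      Function.update (mixedNorm G u T σ) i (τ.1 (u i)) := by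
  funext j
  by_cases hj : j = i
  · subst hj; simp [mixedNorm, hi]
  · simp [mixedNorm, hj]

variable [IsLocalRing A]

theorem algEquiv_mem_maximalIdeal (σ : A ≃ₐ[k] A) {a : A} (ha : a ∈ maximalIdeal A) :
    σ a ∈ maximalIdeal A := by
  rw [IsLocalRing.mem_maximalIdeal, mem_nonunits_iff] at ha ⊢
  rwa [MulEquiv.isUnit_map]

theorem isWeaklyAdmissible_of_norm (hdim : ringKrullDim A = n) {u : Fin n → A}
    (hu : ∀ i, u i ∈ maximalIdeal A) (h : IsSystemOfParameters fun i => norm G (u i)) :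
    IsWeaklyAdmissible G u := by
  intro σ
  refine (isSystemOfParameters_iff hdim).2 ⟨fun i => algEquiv_mem_maximalIdeal _ (hu i), ?_⟩
  refine h.2.2.ge.trans (Ideal.radical_mono (Ideal.span_le.2 ?_))
  rintro _ ⟨i, rfl⟩
  exact norm_mem G (σ i) (Ideal.subset_span ⟨i, rfl⟩)

/-- A prime containing a mixed family contains a conjugate of every `u i`, because a norm in a prime
has a factor there. The intermediate `T` make it possible to expand one norm at a time. -/
theorem IsWeaklyAdmissible.mixedNorm (hdim : ringKrullDim A = n) {u : Fin n → A}
    (hu : ∀ i, u i ∈ maximalIdeal A) (h : IsWeaklyAdmissible G u) (T : Finset (Fin n))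
    (σ : Fin n → G) : IsSystemOfParameters (mixedNorm G u T σ) := by
  refine (isSystemOfParameters_iff hdim).2 ⟨fun i => ?_, ?_⟩
  · unfold NormSubring.mixedNorm
    split_ifs
    · exact norm_mem G 1 (hu i)
    · exact algEquiv_mem_maximalIdeal _ (hu i)
  · rw [Ideal.radical_eq_sInf]
    refine le_sInf fun P ⟨hP, hPp⟩ => ?_
    have hτ : ∀ i, ∃ τ : G, τ.1 (u i) ∈ P := by
      intro i
      have hi := hP (Ideal.subset_span ⟨i, rfl⟩)
      unfold NormSubring.mixedNorm at hi
      split_ifs at hi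
      · obtain ⟨τ, -, hτ⟩ := (hPp.prod_mem_iff).1 hi
        exact ⟨τ, hτ⟩
      · exact ⟨_, hi⟩
    choose τ hτ using hτ
    refine (h τ).2.2.ge.trans ((hPp.radical_le_iff).2 (Ideal.span_le.2 ?_))
    rintro _ ⟨i, rfl⟩
    exact hτ i

variable [IsNoetherianRing A]

/-- Each factor `τ (u i)` of the norm is regular modulo the other entries, because exchanging it
into the family gives another mixed family, again a system of parameters. -/
theorem length_mixedNorm_insert (hr : HasRegularSequence n (⊥ : Ideal A)) {u : Fin n → A}
    (hmix : ∀ T σ, IsSystemOfParameters (mixedNorm G u T σ)) {T : Finset (Fin n)} {i : Fin n}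
    (hi : i ∉ T) (σ : Fin n → G) :
    Module.length k (A ⧸ Ideal.span (Set.range (mixedNorm G u (insert i T) σ))) =
      ∑ τ : G, Module.length k
        (A ⧸ Ideal.span (Set.range (mixedNorm G u T (Function.update σ i τ)))) := by
  rw [mixedNorm_insert, span_range_update, length_quotient_sup_prod k _ _ fun τ _ => ?_]
  · refine Finset.sum_congr rfl fun τ _ => ?_
    rw [mixedNorm_update G u σ hi, span_range_update]
  · refine isRegularMod_of_isSystemOfParameters_update hr ?_
    rw [← mixedNorm_update G u σ hi]
    exact hmix _ _

theorem pow_card_le_length_mixedNorm (hr : HasRegularSequence n (⊥ : Ideal A)) {u : Fin n → A}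
    (hmix : ∀ T σ, IsSystemOfParameters (mixedNorm G u T σ)) (T : Finset (Fin n))
    (σ : Fin n → G) : (Fintype.card G : ℕ∞) ^ T.card ≤
      Module.length k (A ⧸ Ideal.span (Set.range (mixedNorm G u T σ))) := by
  induction T using Finset.induction_on generalizing σ with
  | empty =>
    rw [Finset.card_empty, pow_zero, Order.one_le_iff_pos, Module.length_pos_iff,
      Ideal.Quotient.nontrivial_iff]
    exact fun h => (maximalIdeal.isMaximal A).ne_top (by
      rw [← (hmix ∅ σ).2.2, h, Ideal.radical_top])
  | insert i T hi ih =>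
    rw [length_mixedNorm_insert G hr hmix hi, Finset.card_insert_of_notMem hi, pow_succ']
    calc (Fintype.card G : ℕ∞) * Fintype.card G ^ T.card
        = ∑ _ : G, (Fintype.card G : ℕ∞) ^ T.card := by
          rw [Finset.sum_const, Finset.card_univ, nsmul_eq_mul]
      _ ≤ _ := Finset.sum_le_sum fun τ _ => ih _

theorem length_mixedNorm_eq (hk : IsFieldOfRepresentatives k A)
    (hr : HasRegularSequence n (⊥ : Ideal A)) {u : Fin n → A}
    (hmix : ∀ T σ, IsSystemOfParameters (mixedNorm G u T σ)) (hadm : IsAdmissible G u)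
    (T : Finset (Fin n)) (σ : Fin n → G) :
    Module.length k (A ⧸ Ideal.span (Set.range (mixedNorm G u T σ))) =
      (Fintype.card G : ℕ∞) ^ T.card := by
  induction T using Finset.induction_on generalizing σ with
  | empty =>
    have : mixedNorm G u ∅ σ = fun i => (σ i).1 (u i) := by
      funext i; simp [mixedNorm]
    rw [this, (hadm σ).2, hk.length_quotient_maximalIdeal, Finset.card_empty, pow_zero]
  | insert i T hi ih =>
    rw [length_mixedNorm_insert G hr hmix hi, Finset.card_insert_of_notMem hi, pow_succ']
    simp only [ih, Finset.sum_const, Finset.card_univ, nsmul_eq_mul]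

end Action

/-! ### Freeness over the power series ring. -/

theorem isPrecomplete_pi {R ι : Type*} [CommRing R] [Finite ι] (J : Ideal R)
    [IsPrecomplete J R] : IsPrecomplete J (ι → R) := by
  classical
  cases nonempty_fintype ι
  have hmem (n : ℕ) (f : ι → R) :
      f ∈ (J ^ n • ⊤ : Submodule R (ι → R)) ↔ ∀ i, f i ∈ (J ^ n • ⊤ : Submodule R R) := by
    simp only [smul_eq_mul, Ideal.mul_top]
    constructor
    · intro hf i
      induction hf using Submodule.smul_induction_on' with
      | smul r hr x _ => exact Ideal.mul_mem_right _ _ hr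
      | add x _ y _ hx hy => exact Ideal.add_mem _ hx hy
    · intro hf
      rw [← Finset.univ_sum_single f]
      refine Submodule.sum_mem _ fun i _ => ?_
      rw [show Pi.single i (f i) = f i • (Pi.single i 1 : ι → R) by
        rw [← Pi.single_smul, smul_eq_mul, mul_one]]
      exact Submodule.smul_mem_smul (hf i) trivial
  refine ⟨fun f hf => ?_⟩
  have h : ∀ i, ∃ L : R, ∀ n, f n i ≡ L [SMOD (J ^ n • ⊤ : Submodule R R)] := by
    refine fun i => IsPrecomplete.prec inferInstance fun {m n} hmn => ?_
    rw [SModEq.sub_mem]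
    exact (hmem m _).1 (SModEq.sub_mem.1 (hf hmn)) i
  choose L hL using h
  refine ⟨L, fun n => ?_⟩
  rw [SModEq.sub_mem, hmem]
  exact fun i => SModEq.sub_mem.1 (hL i n)

theorem mem_span_range_X_of_constantCoeff_eq_zero {k : Type*} [CommRing k] {n : ℕ}
    {f : MvPowerSeries (Fin n) k} (hf : MvPowerSeries.constantCoeff f = 0) :
    f ∈ Ideal.span (Set.range (MvPowerSeries.X : Fin n → MvPowerSeries (Fin n) k)) := by
  classical
  -- `g j` collects the monomials of `f` whose variable of least index is `X j`, divided by `X j`;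
  -- every nonconstant monomial is thus counted once.
  let g (j : Fin n) : MvPowerSeries (Fin n) k := fun d =>
    if ∀ l < j, d l = 0 then MvPowerSeries.coeff (d + Finsupp.single j 1) f else 0
  have hg (j : Fin n) (d) : MvPowerSeries.coeff d (g j) =
    if ∀ l < j, d l = 0 then MvPowerSeries.coeff (d + Finsupp.single j 1) f else 0 := rfl
  have hfg : f = ∑ j, g j * MvPowerSeries.X j := by
    ext d
    rw [map_sum]
    have hterm (j : Fin n) : MvPowerSeries.coeff d (g j * MvPowerSeries.X j) =
        if d j ≠ 0 ∧ ∀ l < j, d l = 0 then MvPowerSeries.coeff d f else 0 := by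
      rw [MvPowerSeries.X, MvPowerSeries.coeff_mul_monomial, mul_one]
      by_cases hd : d j = 0
      · rw [if_neg, if_neg (by simp [hd])]
        intro h
        have := h j
        simp [hd] at this
      · have hle : Finsupp.single j 1 ≤ d := by
          rw [Finsupp.single_le_iff]; omega
        rw [if_pos hle, hg, tsub_add_cancel_of_le hle]
        refine if_congr ?_ rfl rfl
        simp only [ne_eq, hd, not_false_eq_true, true_and]
        refine forall₂_congr fun l hl => ?_
        simp [Finsupp.single_eq_of_ne hl.ne]
    simp only [hterm]
    by_cases hd : d = 0
    · subst hd
      simp only [MvPowerSeries.coeff_zero_eq_constantCoeff_apply, hf, ite_self,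
        Finset.sum_const_zero]
    · have hne : (Finset.univ.filter fun j => d j ≠ 0).Nonempty := by
        obtain ⟨j, hj⟩ := Finsupp.ne_iff.1 hd
        exact ⟨j, by simpa using hj⟩
      obtain ⟨j, hj, hmin⟩ := Finset.exists_min_image _ id hne
      have hj' : d j ≠ 0 := by simpa using hj
      have hlt : ∀ l < j, d l = 0 := fun l hl => by
        by_contra h
        exact absurd (hmin l (by simpa using h)) (not_le.2 hl)
      rw [Finset.sum_eq_single j, if_pos ⟨hj', hlt⟩]
      · intro l _ hl
        refine if_neg fun ⟨h1, h2⟩ => ?_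
        rcases lt_trichotomy l j with h | h | h
        · exact h1 (hlt l h)
        · exact hl h
        · exact hj' (h2 j h)
      · simp
  rw [hfg]
  exact Ideal.sum_mem _ fun j _ => Ideal.mul_mem_left _ _ (Ideal.subset_span ⟨j, rfl⟩)

section Regular

variable {R A F : Type*} [CommRing R] [CommRing A] [Algebra R A] [AddCommGroup F] [Module R F]

/-- If the images of the `X j` in `A` form a regular sequence in every order, then a relation
`∑ X j • f (g j) = 0` lifts along a surjection `f`. -/
theorem exists_lift_of_sum_smul_eq_zero {ι : Type*} [DecidableEq ι] (X : ι → R) (f : F →ₗ[R] A)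
    (hf : Function.Surjective f) (T : Finset ι)
    (hreg : ∀ S : Finset ι, ∀ j ∉ S,
      IsRegularMod (Ideal.span ((fun i => algebraMap R A (X i)) '' S)) (algebraMap R A (X j)))
    (g : ι → F) (hg : ∑ j ∈ T, X j • f (g j) = 0) :
    ∃ g' : ι → F, (∀ j ∈ T, f (g' j) = 0) ∧ ∑ j ∈ T, X j • g' j = ∑ j ∈ T, X j • g j := by
  induction T using Finset.induction_on generalizing g with
  | empty => exact ⟨g, by simp, rfl⟩
  | insert j T hj ih =>
    rw [Finset.sum_insert hj] at hg
    -- The relation puts `X j • f (g j)` in the ideal of the remaining variables, modulo which `X j`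
    -- is regular.
    have hmem : f (g j) ∈ Ideal.span ((fun i => algebraMap R A (X i)) '' T) := by
      refine hreg T j hj _ ?_
      rw [← Algebra.smul_def, eq_neg_of_add_eq_zero_left hg]
      refine Ideal.neg_mem_iff _ |>.2 (Ideal.sum_mem _ fun l hl => ?_)
      rw [Algebra.smul_def]
      exact Ideal.mul_mem_right _ _ (Ideal.subset_span ⟨l, hl, rfl⟩)
    obtain ⟨c, hc⟩ := (Submodule.mem_span_image_finset_iff_exists_fun' A).1 hmem
    choose b hb using fun l => hf (c l)
    have hfj : f (g j) = ∑ l ∈ T, X l • f (b l) := by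
      rw [← hc]
      exact Finset.sum_congr rfl fun l _ => by rw [hb, smul_eq_mul, Algebra.smul_def, mul_comm]
    -- Adding the Koszul relations between `X j` and the `X l` moves `∑ X l • b l` out of `g j`: the
    -- total is unchanged, the new `j`-th entry is killed by `f`, and the rest is a shorter
    -- relation.
    obtain ⟨g', hg', hsum⟩ := ih (fun l => g l + X j • b l) (by
      rw [← hg, hfj]
      simp only [map_add, map_smul, smul_add, Finset.sum_add_distrib, Finset.smul_sum]
      rw [add_comm]
      simp only [smul_comm (X j)])
    refine ⟨Function.update g' j (g j - ∑ l ∈ T, X l • b l), ?_, ?_⟩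
    · intro l hl
      rcases Finset.mem_insert.1 hl with rfl | hl
      · rw [Function.update_self, map_sub, hfj, map_sum]
        simp
      · rw [Function.update_of_ne (ne_of_mem_of_not_mem hl hj)]
        exact hg' l hl
    · rw [Finset.sum_insert hj, Finset.sum_insert hj, Function.update_self]
      have : ∑ l ∈ T, X l • Function.update g' j (g j - ∑ l ∈ T, X l • b l) l =
          ∑ l ∈ T, X l • g' l := Finset.sum_congr rfl fun l hl => by
        rw [Function.update_of_ne (ne_of_mem_of_not_mem hl hj)]
      rw [this, hsum]
      simp only [smul_add, smul_sub, Finset.sum_add_distrib, Finset.smul_sum]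
      simp only [smul_comm (X j)]
      abel

end Regular

/-- If the images `x i` of the variables form a regular sequence in every order and `A ⧸ (x)` is
finite over `k`, then `A` is free over the power series ring, of rank `dim_k A ⧸ (x)`. -/
theorem exists_linearEquiv_of_isRegularMod {k A : Type*} [Field k] [CommRing A] [IsLocalRing A]
    [IsNoetherianRing A] [Algebra k A] {n : ℕ} [Algebra (MvPowerSeries (Fin n) k) A]
    [IsScalarTower k (MvPowerSeries (Fin n) k) A] (x : Fin n → A)
    (hX : ∀ i, algebraMap (MvPowerSeries (Fin n) k) A (MvPowerSeries.X i) = x i)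
    (hx : ∀ i, x i ∈ maximalIdeal A)
    (hreg : ∀ S : Finset (Fin n), ∀ j ∉ S, IsRegularMod (Ideal.span (x '' S)) (x j))
    [Module.Finite k (A ⧸ Ideal.span (Set.range x))] :
    Nonempty ((Fin (Module.finrank k (A ⧸ Ideal.span (Set.range x))) →
      MvPowerSeries (Fin n) k) ≃ₗ[MvPowerSeries (Fin n) k] A) := by
  classical
  set R := MvPowerSeries (Fin n) k
  set J : Ideal R := Ideal.span (Set.range MvPowerSeries.X) with hJ
  have hJA : J.map (algebraMap R A) = Ideal.span (Set.range x) := by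
    rw [hJ, Ideal.map_span, ← Set.range_comp]
    congr 2
    exact funext hX
  let b := Module.finBasis k (A ⧸ Ideal.span (Set.range x))
  choose e he using fun i => Ideal.Quotient.mk_surjective (b i)
  have hcoeff (c : R) : algebraMap R A c - algebraMap k A (MvPowerSeries.constantCoeff c) ∈
      Ideal.span (Set.range x) := by
    rw [IsScalarTower.algebraMap_apply k R A, ← map_sub, ← hJA]
    refine Ideal.mem_map_of_mem _ (mem_span_range_X_of_constantCoeff_eq_zero ?_)
    rw [map_sub, sub_eq_zero]
    exact (MvPowerSeries.constantCoeff_C _).symm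
  let f : (Fin (Module.finrank k (A ⧸ Ideal.span (Set.range x))) → R) →ₗ[R] A :=
    Fintype.linearCombination R e
  have hf (c) : f c = ∑ i, algebraMap R A (c i) * e i := by
    simp [f, Fintype.linearCombination_apply, Algebra.smul_def]
  have hmk (c) : Ideal.Quotient.mk (Ideal.span (Set.range x)) (f c) =
      ∑ i, MvPowerSeries.constantCoeff (c i) • b i := by
    rw [hf, map_sum]
    refine Finset.sum_congr rfl fun i _ => ?_
    rw [map_mul, he, Ideal.Quotient.eq.2 (hcoeff (c i)), Algebra.smul_def]
    rfl
  have hJtop : (J • ⊤ : Submodule R A) = (Ideal.span (Set.range x)).restrictScalars R := by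
    rw [Ideal.smul_top_eq_map, hJA]
  have hspan : Ideal.span (Set.range x) ≠ ⊤ := fun h =>
    (maximalIdeal.isMaximal A).ne_top (top_le_iff.1 (h ▸ Ideal.span_le.2 (by
      rintro _ ⟨i, rfl⟩; exact hx i)))
  -- Modulo `J` the `e i` become a `k`-basis; surjectivity lifts since the free module is
  -- `J`-adically precomplete and `A` is `J`-adically separated.
  have hsurj : Function.Surjective f := by
    have : IsHausdorff J A := by
      rw [← IsHausdorff.map_algebraMap_iff (S := A), hJA]
      exact IsHausdorff.of_isLocalRing _ _ hspan
    have := isPrecomplete_pi (ι := Fin (Module.finrank k (A ⧸ Ideal.span (Set.range x)))) J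
    apply surjective_of_mkQ_comp_surjective (I := J)
    intro y
    obtain ⟨a, rfl⟩ := Submodule.Quotient.mk_surjective _ y
    refine ⟨fun i => MvPowerSeries.C (b.repr (Ideal.Quotient.mk _ a) i), ?_⟩
    rw [LinearMap.comp_apply, Submodule.mkQ_apply, Submodule.Quotient.eq, hJtop,
      Submodule.restrictScalars_mem, ← Ideal.Quotient.eq, hmk]
    simp only [MvPowerSeries.constantCoeff_C]
    exact b.sum_repr _
  -- A kernel element has zero constant coefficients, so it is `∑ X j • g j`. By the lifting lemma
  -- the `g j` may be taken in the kernel, which therefore equals `J` times itself and vanishes by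
  -- Nakayama.
  have hinj : Function.Injective f := by
    rw [← LinearMap.ker_eq_bot]
    refine Submodule.eq_bot_of_le_smul_of_le_jacobson_bot J _ (IsNoetherian.noetherian _) ?_
      (IsAdicComplete.le_jacobson_bot J)
    intro c hc
    rw [LinearMap.mem_ker] at hc
    have h0 := hmk c
    rw [hc, map_zero] at h0
    have hc0 := Fintype.linearIndependent_iff.1 b.linearIndependent _ h0.symm
    have hcJ (i) : ∃ g : Fin n → R, ∑ j, g j * MvPowerSeries.X j = c i :=
      Ideal.mem_span_range_iff_exists_fun.1 (mem_span_range_X_of_constantCoeff_eq_zero (hc0 i))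
    choose g hg using hcJ
    have hcg : c = ∑ j, (MvPowerSeries.X j : R) • fun i => g i j := by
      funext i
      rw [← hg, Finset.sum_apply]
      exact Finset.sum_congr rfl fun j _ => by rw [Pi.smul_apply, smul_eq_mul, mul_comm]
    obtain ⟨g', hg', hsum⟩ := exists_lift_of_sum_smul_eq_zero
      (MvPowerSeries.X : Fin n → R) f hsurj Finset.univ (by simpa only [hX] using hreg)
      (fun j i => g i j) (by
        rw [← hc]
        nth_rw 1 [hcg]
        simp only [map_sum, map_smul])
    rw [hcg, ← hsum]
    exact Submodule.sum_mem _ fun j hj => Submodule.smul_mem_smul (Ideal.subset_span ⟨j, rfl⟩)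
      (hg' j hj)
  exact ⟨LinearEquiv.ofBijective f ⟨hinj, hsurj⟩⟩

end NormSubring

theorem NormSubring.powerSeriesHom_finite_flat_degree {k A : Type*} [Field k] [CommRing A]
    [IsLocalRing A] [IsNoetherianRing A]
    [IsAdicComplete (IsLocalRing.maximalIdeal A) A] [Algebra k A]
    (hk : NormSubring.IsFieldOfRepresentatives k A) {n : ℕ} {x : Fin n → A}
    (hr : NormSubring.HasRegularSequence n (⊥ : Ideal A))
    (hx : NormSubring.IsSystemOfParameters x) :
    (NormSubring.powerSeriesHom k x hx.mem).toRingHom.Finite ∧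
      (NormSubring.powerSeriesHom k x hx.mem).toRingHom.Flat ∧
      (NormSubring.degree (NormSubring.powerSeriesHom k x hx.mem).toRingHom : ℕ∞) =
        Module.length k (A ⧸ Ideal.span (Set.range x)) := by
  have hfin := hk.finite_quotient hx.2.2.ge
  let φ := NormSubring.powerSeriesHom k x hx.mem
  let : Algebra (MvPowerSeries (Fin n) k) A := φ.toRingHom.toAlgebra
  have : IsScalarTower k (MvPowerSeries (Fin n) k) A :=
    IsScalarTower.of_algebraMap_eq fun c => (φ.commutes c).symm
  obtain ⟨e⟩ := NormSubring.exists_linearEquiv_of_isRegularMod (k := k) x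
    (NormSubring.powerSeriesHom_X k x hx.mem) hx.mem
    fun S => (NormSubring.HasRegularSequence.sup_span_image hx.mem hr hx.2.2.ge S).2
  have hF : Module.Finite (MvPowerSeries (Fin n) k) A := Module.Finite.equiv e
  have hFree : Module.Free (MvPowerSeries (Fin n) k) A := Module.Free.of_equiv e
  have hFlat : Module.Flat (MvPowerSeries (Fin n) k) A := inferInstance
  refine ⟨hF, hFlat, ?_⟩
  have hdeg : NormSubring.degree φ.toRingHom =
      Module.finrank k (A ⧸ Ideal.span (Set.range x)) := by
    change Module.finrank (MvPowerSeries (Fin n) k) A = _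
    rw [← e.finrank_eq, Module.finrank_fin_fun]
  rw [Module.length_eq_finrank]
  exact_mod_cast hdeg

theorem mainTheorem11 {k A : Type*} [Field k] [CommRing A] [IsRegularLocalRing A]
    [IsAdicComplete (IsLocalRing.maximalIdeal A) A] [Algebra k A]
    (hk : NormSubring.IsFieldOfRepresentatives k A)
    (n : ℕ) (hn : 1 ≤ n) (hdim : ringKrullDim A = n)
    (G : Subgroup (A ≃ₐ[k] A)) [Fintype G]
    (u : Fin n → A) (hu : NormSubring.IsRegularSystemOfParameters u) :
    (NormSubring.IsSystemOfParameters (fun i => NormSubring.norm G (u i)) ↔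
        NormSubring.IsWeaklyAdmissible G u) ∧
      ∀ hx : NormSubring.IsSystemOfParameters (fun i => NormSubring.norm G (u i)),
        (NormSubring.powerSeriesHom k (fun i => NormSubring.norm G (u i)) hx.mem).toRingHom.Finite ∧
        (NormSubring.powerSeriesHom k (fun i => NormSubring.norm G (u i)) hx.mem).toRingHom.Flat ∧
        Fintype.card G ^ n ≤ NormSubring.degree
          (NormSubring.powerSeriesHom k (fun i => NormSubring.norm G (u i)) hx.mem).toRingHom ∧
        (NormSubring.IsAdmissible G u →
          NormSubring.degree
            (NormSubring.powerSeriesHom k (fun i => NormSubring.norm G (u i)) hx.mem).toRingHom =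
              Fintype.card G ^ n) := by
  have hum : ∀ i, u i ∈ IsLocalRing.maximalIdeal A := fun i =>
    hu.2 ▸ Ideal.subset_span ⟨i, rfl⟩
  have hr := hu.hasRegularSequence
  -- With `T` everything, no index reads `σ`, so `1` is an arbitrary value.
  have hmix : NormSubring.mixedNorm G u Finset.univ 1 = fun i => NormSubring.norm G (u i) := by
    funext i
    simp [NormSubring.mixedNorm]
  refine ⟨⟨NormSubring.isWeaklyAdmissible_of_norm G hdim hum, fun h => ?_⟩, fun hx => ?_⟩
  · rw [← hmix]
    exact h.mixedNorm G hdim hum _ _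
  · have hall := (NormSubring.isWeaklyAdmissible_of_norm G hdim hum hx).mixedNorm G hdim hum
    obtain ⟨h1, h2, h3⟩ := NormSubring.powerSeriesHom_finite_flat_degree hk hr hx
    refine ⟨h1, h2, ?_, fun hadm => ?_⟩
    · have := NormSubring.pow_card_le_length_mixedNorm G hr hall Finset.univ 1
      rw [hmix, ← h3, Finset.card_univ, Fintype.card_fin] at this
      exact_mod_cast this
    · have := NormSubring.length_mixedNorm_eq G hk hr hall hadm Finset.univ 1
      rw [hmix, ← h3, Finset.card_univ, Fintype.card_fin] at this
      exact_mod_cast this
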